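/- Let $\mathcal A$ be an arbitrary set (of actions). A \emph{stateless decision process} (SDP) with action set $\mathcal A$ is a probability space $(\Omega,\mathcal G,\mathbb P)$ together with, for every horizon $H\in\mathbb N\cup\{\infty\}$, a random map $\mathcal F_H:\Omega\to(\mathcal A^H\to\mathbb R^H)$; that is, for every action sequence $\tau=(a_h)_{h\le H}$ the rewards $\mathcal F_H(\tau)=(Y_{\tau,h})_{h\le H}$, $\omega\mapsto\mathcal F_H(\omega)(\tau)$, are real random variables. (For $H=\infty$ the sequences are indexed by all positive integers.) The SDP is \emph{coherent} if for all $H,H'\in\mathbb N\cup\{\infty\}$, all integers $1\le h\le k$ with $k\le H$ and $k\le H'$, and all action sequences $\tau,\tau'$ of lengths $H,H'$ that have the same actions at the steps $h,\dots,k$, one has $(Y_{\tau,h},\dots,Y_{\tau,k})=(Y_{\tau',h},\dots,Y_{\tau',k})$ as functions on $\Omega$. It is \emph{exchangeable} if for every $H\in\mathbb N\cup\{\infty\}$, every action sequence $(a_h)_{h\le H}$ with rewards $(Y_h)_{h\le H}=\mathcal F_H((a_h)_{h\le H})$, and every permutation $\pi$ of the set of steps, the random vectors $\mathcal F_H((a_{\pi(h)})_{h\le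 H})$ and $(Y_{\pi(h)})_{h\le H}$ have the same distribution. Let $\mathcal P(\mathbb R)$ be the set of Borel probability measures on $\mathbb R$ with the Borel $\sigma$-algebra of the topology of weak convergence, and give $\mathcal P(\mathbb R)^{\mathcal A}$ the product $\sigma$-algebra (for countable $\mathcal A$ this is the Borel $\sigma$-algebra of the topology of pointwise convergence). \textbf{Theorem (De Finetti theorem for stateless decision processes).} Every exchangeable and coherent stateless decision process is a latent bandit. That is, there is a measurable map $F:\Omega\to\mathcal P(\mathbb R)^{\mathcal A}$ on the same probability space such that, for every $H\in\mathbb N\cup\{\infty\}$ and every action sequence $(a_h)_{h\le H}$, the rewards $(Y_h)_{h\le H}=\mathcal F_H((a_h)_{h\le H})$ are conditionally independent given $F$, and for every step $h\le H$ the regular conditional distribution of $Y_h$ given $F$ is $\mathcal L[Y_h\mid F]=F(a_h)$ almost surely, where $F(a)(\omega):=F(\omega)(a)$. -/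

import Mathlib

open MeasureTheory ProbabilityTheory Set Filter Topology

/-- The steps of a trajectory with horizon `H ∈ ℕ ∪ {∞}`, counted from `0`: the set of all `i : ℕ`
with `i < H`. It has `H` elements if `H` is finite, and it is a copy of `ℕ` if `H = ∞`. -/
abbrev Steps (H : ℕ∞) : Type := {i : ℕ // (i : ℕ∞) < H}

/-- A stateless decision process with action set `𝒜` on the probability space `(Ω, P)`: for each
horizon `H ∈ ℕ ∪ {∞}` a random map from action sequences of length `H` to reward sequences of
length `H`. Spaces of maps carry the product `σ`-algebra, so measurability says that the reward
sequence of each action sequence is a random vector. -/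
structure StatelessDecisionProcess (𝒜 : Type*) {Ω : Type*} [MeasurableSpace Ω]
    (P : Measure Ω) [IsProbabilityMeasure P] where
  /-- The random map with horizon `H`. -/
  rewards : ∀ H : ℕ∞, Ω → (Steps H → 𝒜) → (Steps H → ℝ)
  measurable_rewards : ∀ H : ℕ∞, Measurable (rewards H)

/-- Conditional independence, given the `σ`-algebra `m`, of a family `Y` of real random variables on
an arbitrary probability space: for any finitely many indices `s` and Borel sets `B i`, almost
surely `P(Y i ∈ B i for all i ∈ s | m) = ∏ i ∈ s, P(Y i ∈ B i | m)`. -/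
def CondIndepGiven {Ω ι : Type*} (m : MeasurableSpace Ω) {mΩ : MeasurableSpace Ω}
    (P : Measure Ω) (Y : ι → Ω → ℝ) : Prop :=
  ∀ (s : Finset ι) (B : ι → Set ℝ), (∀ i ∈ s, MeasurableSet (B i)) →
    P⟦⋂ i ∈ s, Y i ⁻¹' B i | m⟧ =ᵐ[P] ∏ i ∈ s, P⟦Y i ⁻¹' B i | m⟧

namespace StatelessDecisionProcess

variable {𝒜 Ω : Type*} [MeasurableSpace Ω] {P : Measure Ω} [IsProbabilityMeasure P]

/-- Coherence: if two action sequences, of lengths `H` and `H'`, share the actions at the steps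
`h, …, k`, then their rewards at the steps `h, …, k` are equal as functions on `Ω`. -/
def Coherent (D : StatelessDecisionProcess 𝒜 P) : Prop :=
  ∀ (H H' : ℕ∞) (τ : Steps H → 𝒜) (τ' : Steps H' → 𝒜) (h k : ℕ),
    h ≤ k → (k : ℕ∞) < H → (k : ℕ∞) < H' →
    (∀ (i : ℕ) (hi : (i : ℕ∞) < H) (hi' : (i : ℕ∞) < H'),
      h ≤ i → i ≤ k → τ ⟨i, hi⟩ = τ' ⟨i, hi'⟩) →
    ∀ (i : ℕ) (hi : (i : ℕ∞) < H) (hi' : (i : ℕ∞) < H'), h ≤ i → i ≤ k →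
      (fun ω => D.rewards H ω τ ⟨i, hi⟩) = (fun ω => D.rewards H' ω τ' ⟨i, hi'⟩)

/-- Exchangeability: permuting the actions leads to the distribution of the permuted rewards. -/
def Exchangeable (D : StatelessDecisionProcess 𝒜 P) : Prop :=
  ∀ (H : ℕ∞) (π : Equiv.Perm (Steps H)) (τ : Steps H → 𝒜),
    IdentDistrib (fun ω => D.rewards H ω (fun i => τ (π i)))
      (fun ω => fun i => D.rewards H ω τ (π i)) P P

/-- `D` is a latent bandit: there is a random measure-valued function `F` on the actions such that,
for any action sequence, the rewards are independent conditionally on `F`, and the regular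
conditional distribution of the reward at step `h` given `F` is `F (a_h)`, almost surely. -/
def IsLatentBandit (D : StatelessDecisionProcess 𝒜 P) : Prop :=
  ∃ F : Ω → 𝒜 → ProbabilityMeasure ℝ, Measurable F ∧
    ∀ (H : ℕ∞) (τ : Steps H → 𝒜),
      CondIndepGiven (MeasurableSpace.comap F inferInstance) P
        (fun (h : Steps H) ω => D.rewards H ω τ h) ∧
      ∀ h : Steps H,
        ∀ᵐ ω ∂P, condDistrib (fun ω => D.rewards H ω τ h) F P (F ω) = (F ω (τ h) : Measure ℝ)

end StatelessDecisionProcess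

/-- The evaluation at an open set is lower semicontinuous for weak convergence. -/
theorem isOpen_setOf_lt_measure {U : Set ℝ} (hU : IsOpen U) (c : ENNReal) :
    IsOpen {μ : ProbabilityMeasure ℝ | c < (μ : Measure ℝ) U} := by
  rw [isOpen_iff_mem_nhds]
  intro μ hμ
  have h := ProbabilityMeasure.le_liminf_measure_open_of_tendsto
    (tendsto_id (x := 𝓝 μ)) hU
  exact eventually_lt_of_lt_liminf (lt_of_lt_of_le hμ h)

/-- The topology of weak convergence on the probability measures on `ℝ` has a countable subbasis
of sets that are measurable for Mathlib's `σ`-algebra. -/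
theorem exists_countable_subbasis_probabilityMeasure_real :
    ∃ 𝒮 : Set (Set (ProbabilityMeasure ℝ)), 𝒮.Countable ∧
      (inferInstance : TopologicalSpace (ProbabilityMeasure ℝ)) =
        TopologicalSpace.generateFrom 𝒮 ∧ ∀ s ∈ 𝒮, MeasurableSet s := by
  let 𝒮 : Set (Set (ProbabilityMeasure ℝ)) :=
    range fun p : Finset (TopologicalSpace.countableBasis ℝ) × ℚ =>
      {μ : ProbabilityMeasure ℝ |
        ENNReal.ofReal p.2 < (μ : Measure ℝ) (⋃ u ∈ p.1, (u : Set ℝ))}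
  have hopen : ∀ s : Finset (TopologicalSpace.countableBasis ℝ),
      IsOpen (⋃ u ∈ s, (u : Set ℝ)) := fun s =>
    isOpen_biUnion fun u _ => TopologicalSpace.isOpen_of_mem_countableBasis u.2
  have h𝒮c : 𝒮.Countable := countable_range _
  refine ⟨𝒮, h𝒮c, ?_, ?_⟩
  swap
  · rintro _ ⟨p, rfl⟩
    exact measurableSet_lt measurable_const
      ((Measure.measurable_coe (hopen p.1).measurableSet).comp measurable_subtype_coe)
  · apply le_antisymm
    · refine le_generateFrom ?_
      rintro _ ⟨p, rfl⟩
      exact isOpen_setOf_lt_measure (hopen p.1) _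
    · rw [← continuous_id_iff_le]
      rw [@continuous_iff_continuousAt _ _ (TopologicalSpace.generateFrom 𝒮)]
      intro μ
      have hfc : @FirstCountableTopology _ (TopologicalSpace.generateFrom 𝒮) := by
        have : @SecondCountableTopology _ (TopologicalSpace.generateFrom 𝒮) :=
          @SecondCountableTopology.mk _ (TopologicalSpace.generateFrom 𝒮) ⟨𝒮, h𝒮c, rfl⟩
        let _ : TopologicalSpace (ProbabilityMeasure ℝ) := TopologicalSpace.generateFrom 𝒮
        infer_instance
      have hcg : (@nhds _ (TopologicalSpace.generateFrom 𝒮) μ).IsCountablyGenerated :=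
        @FirstCountableTopology.nhds_generated_countable _ (TopologicalSpace.generateFrom 𝒮) hfc μ
      refine tendsto_of_forall_isOpen_le_liminf' (fun G hG => ?_)
      refine le_of_forall_lt fun c hc => ?_
      obtain ⟨d, hcd, hdG⟩ := exists_between hc
      -- approximate `G` from inside by a finite union of basic sets
      let T : Set (TopologicalSpace.countableBasis ℝ) := {u | (u : Set ℝ) ⊆ G}
      have hGT : G = ⋃ u : T, ((u : TopologicalSpace.countableBasis ℝ) : Set ℝ) := by
        apply Subset.antisymm
        · intro x hx
          obtain ⟨v, hv, hxv, hvG⟩ :=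
            (TopologicalSpace.isBasis_countableBasis ℝ).exists_subset_of_mem_open hx hG
          exact mem_iUnion.2 ⟨⟨⟨v, hv⟩, hvG⟩, hxv⟩
        · exact iUnion_subset fun u => u.2
      have hsup : (μ : Measure ℝ) G =
          ⨆ s : Finset T, (μ : Measure ℝ)
            (⋃ u ∈ s, ((u : TopologicalSpace.countableBasis ℝ) : Set ℝ)) := by
        have hm : Monotone fun s : Finset T =>
            (⋃ u ∈ s, ((u : TopologicalSpace.countableBasis ℝ) : Set ℝ)) :=
          fun s t hst => biUnion_subset_biUnion_left hst
        rw [← hm.directed_le.measure_iUnion]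
        conv_lhs => rw [hGT, iUnion_eq_iUnion_finset]
      rw [id, hsup, lt_iSup_iff] at hdG
      obtain ⟨s, hs⟩ := hdG
      obtain ⟨q, -, hdq, hqs⟩ := ENNReal.lt_iff_exists_rat_btwn.1 hs
      classical
      let s' : Finset (TopologicalSpace.countableBasis ℝ) := s.image Subtype.val
      have hs' : (⋃ u ∈ s', (u : Set ℝ)) =
          ⋃ u ∈ s, ((u : TopologicalSpace.countableBasis ℝ) : Set ℝ) := by
        simp [s']
      have hs'G : (⋃ u ∈ s', (u : Set ℝ)) ⊆ G := by
        rw [hs']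
        exact iUnion₂_subset fun u _ => u.2
      have hev : ∀ᶠ ν in @nhds _ (TopologicalSpace.generateFrom 𝒮) μ,
          d ≤ ((id ν : ProbabilityMeasure ℝ) : Measure ℝ) G := by
        have hmem : {ν : ProbabilityMeasure ℝ |
            ENNReal.ofReal q < (ν : Measure ℝ) (⋃ u ∈ s', (u : Set ℝ))} ∈
            @nhds _ (TopologicalSpace.generateFrom 𝒮) μ := by
          refine @IsOpen.mem_nhds _ (TopologicalSpace.generateFrom 𝒮) _ _
            (TopologicalSpace.isOpen_generateFrom_of_mem (mem_range_self (s', q))) ?_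
          change ENNReal.ofReal q < (μ : Measure ℝ) (⋃ u ∈ s', (u : Set ℝ))
          rw [hs']
          exact hqs
        filter_upwards [hmem] with ν hν
        exact (hdq.le.trans (le_of_lt hν)).trans (measure_mono hs'G)
      exact lt_of_lt_of_le hcd (le_liminf_of_le (by isBoundedDefault) hev)

instance secondCountableTopology_probabilityMeasure_real :
    SecondCountableTopology (ProbabilityMeasure ℝ) := by
  obtain ⟨𝒮, h𝒮c, htop, -⟩ := exists_countable_subbasis_probabilityMeasure_real
  exact ⟨⟨𝒮, h𝒮c, htop⟩⟩

/-- The `σ`-algebra that Mathlib puts on the probability measures on `ℝ`, and hence the one used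
for `F` in `IsLatentBandit`, is the Borel `σ`-algebra of the topology of weak convergence. -/
instance borelSpace_probabilityMeasure_real : BorelSpace (ProbabilityMeasure ℝ) := by
  obtain ⟨𝒮, -, htop, hmeas⟩ := exists_countable_subbasis_probabilityMeasure_real
  refine ⟨le_antisymm ?_ ?_⟩
  · -- evaluations at Borel sets are Borel measurable
    have key : @Measurable _ _ (borel (ProbabilityMeasure ℝ)) _
        (fun μ : ProbabilityMeasure ℝ => (μ : Measure ℝ)) := by
      refine @Measurable.measure_of_isPiSystem_of_isProbabilityMeasure _ _
        (borel (ProbabilityMeasure ℝ)) _ _ (fun _ => inferInstance) {U : Set ℝ | IsOpen U}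
        (BorelSpace.measurable_eq (α := ℝ)) isPiSystem_isOpen ?_
      intro U hU
      let _ : MeasurableSpace (ProbabilityMeasure ℝ) := borel (ProbabilityMeasure ℝ)
      refine measurable_of_Ioi ?_
      intro c
      exact MeasurableSpace.measurableSet_generateFrom (isOpen_setOf_lt_measure hU c)
    exact key.comap_le
  · rw [borel_eq_generateFrom_of_subbasis htop]
    exact MeasurableSpace.generateFrom_le hmeas

/-- For countably many actions, the `σ`-algebra used for `F` in `IsLatentBandit` is the Borel
`σ`-algebra of the topology of pointwise weak convergence. -/
theorem borelSpace_pi_probabilityMeasure_real (𝒜 : Type*) [Countable 𝒜] :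
    BorelSpace (𝒜 → ProbabilityMeasure ℝ) :=
  inferInstance

/-! By coherence, the reward at a step depends only on the step `i` and the action `a` played there,
so the process is an array `Z i a`. Exchangeability then says that the joint law of rewards at
distinct steps depends on the actions but not on the steps. It says nothing about the joint law of
`Z i a` and `Z i b` at one step, so the argument must keep different actions on different steps.

For a fixed action the array is an exchangeable sequence. The directing measure of `a` is the
conditional law of `Z 0 a` given the rewards of `a` at the odd steps. Empirical frequencies of `a`
along any injective sequence of steps disjoint from the odd ones converge to it in `L²` with squared
error at most `1 / n`; this is a second-moment computation followed by an orthogonal projection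
(`integral_sq_frequency_sub_directingKernel_le`). Hence the same kernel, evaluated along another
sequence of steps, gives the same measure almost surely (`directingKernel_ae_eq`).

Conditional independence comes from averaging. Inside an expectation, the reward of `a` at a fresh
step may be moved to any other fresh step, hence replaced by a frequency, hence by the directing
measure (`integral_mul_indicator_eq_directing`). The remaining factor may involve the directing
measures of finitely many actions, because these can be recomputed from steps disjoint from all
others (`measureReal_inter_reward`). Uniqueness of projective limits passes from finitely many
actions to all of them, and induction on the number of rewards gives the product formula. -/

/-- An array of random variables, indexed by steps and actions, such that permuting the steps does
not change the distribution of the rewards of a given sequence of actions. -/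
def IsExchangeableArray {𝒜 Ω : Type*} [MeasurableSpace Ω] (P : Measure Ω)
    (Z : ℕ → 𝒜 → Ω → ℝ) : Prop :=
  ∀ (π : Equiv.Perm ℕ) (σ : ℕ → 𝒜),
    P.map (fun ω i => Z i (σ i) ω) = P.map (fun ω i => Z (π i) (σ i) ω)

/-! ### Joint laws do not depend on the steps -/

namespace IsExchangeableArray

variable {𝒜 Ω : Type*} [MeasurableSpace Ω] {P : Measure Ω}
  {Z : ℕ → 𝒜 → Ω → ℝ}

theorem map_eq_of_fintype (hZ : IsExchangeableArray P Z) (hm : ∀ i a, Measurable (Z i a))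
    {ι : Type*} [Fintype ι] {u v : ι → ℕ} (hu : u.Injective) (hv : v.Injective) (σ : ι → 𝒜) :
    P.map (fun ω i => Z (u i) (σ i) ω) = P.map (fun ω i => Z (v i) (σ i) ω) := by
  rcases isEmpty_or_nonempty ι with hι | ⟨⟨i₀⟩⟩
  · congr 1
    funext ω i
    exact hι.elim i
  let ε := Fintype.equivFin ι
  have htrans := Equiv.Perm.isMultiplyPretransitive ℕ (Fintype.card ι)
  -- The permutations of `ℕ` act `n`-transitively for every `n`, so one of them carries `u` to `v`.
  obtain ⟨π, hπ⟩ := MulAction.isMultiplyPretransitive_iff.1 htrans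
    ⟨u ∘ ε.symm, hu.comp ε.symm.injective⟩ ⟨v ∘ ε.symm, hv.comp ε.symm.injective⟩
  have hπ' : ∀ i, π (u i) = v i := fun i => by
    simpa using DFunLike.congr_fun hπ (ε i)
  -- The value `σ i₀` off the range of `u` is arbitrary: those steps are projected away.
  let σ' : ℕ → 𝒜 := Function.extend u σ fun _ => σ i₀
  have hσ' : ∀ i, σ' (u i) = σ i := fun i => hu.extend_apply _ _ i
  have hr : Measurable fun (y : ℕ → ℝ) (i : ι) => y (u i) := by fun_prop
  have h := congrArg (Measure.map fun (y : ℕ → ℝ) (i : ι) => y (u i)) (hZ π σ')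
  rw [Measure.map_map hr (measurable_pi_lambda _ fun i => hm _ _),
    Measure.map_map hr (measurable_pi_lambda _ fun i => hm _ _)] at h
  simpa [Function.comp_def, hσ', hπ'] using h

variable [IsProbabilityMeasure P]

/-- The joint distribution of finitely or countably many rewards at distinct steps does not depend
on the steps. -/
theorem map_eq_of_injective (hZ : IsExchangeableArray P Z) (hm : ∀ i a, Measurable (Z i a))
    {ι : Type*} {u v : ι → ℕ} (hu : u.Injective) (hv : v.Injective) (σ : ι → 𝒜) :
    P.map (fun ω i => Z (u i) (σ i) ω) = P.map (fun ω i => Z (v i) (σ i) ω) := by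
  have hfin : ∀ w : ι → ℕ, ∀ I : Finset ι,
      (P.map (fun ω i => Z (w i) (σ i) ω)).map I.restrict =
        P.map (fun ω (i : I) => Z (w i) (σ i) ω) := fun w I => by
    rw [Measure.map_map (by fun_prop) (measurable_pi_lambda _ fun i => hm _ _)]
    rfl
  -- For infinite `ι` there may be no permutation carrying `u` to `v`, as their ranges can have
  -- complements of different size; the finite marginals still agree and determine the law.
  have hlim : IsProjectiveLimit (P.map fun ω i => Z (u i) (σ i) ω)
      fun I : Finset ι => P.map fun ω (i : I) => Z (v i) (σ i) ω := fun I => by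
    rw [hfin u]
    exact hZ.map_eq_of_fintype hm (hu.comp Subtype.val_injective)
      (hv.comp Subtype.val_injective) fun i : I => σ i
  have (I : Finset ι) : IsFiniteMeasure (P.map fun ω (i : I) => Z (v i) (σ i) ω) :=
    Measure.isFiniteMeasure_map _ _
  exact hlim.unique (hfin v)

/-- Expectations of functions of rewards at distinct steps do not depend on the steps. -/
theorem integral_eq_of_injective (hZ : IsExchangeableArray P Z) (hm : ∀ i a, Measurable (Z i a))
    {ι : Type*} {u v : ι → ℕ} (hu : u.Injective) (hv : v.Injective) (σ : ι → 𝒜)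
    {f : (ι → ℝ) → ℝ} (hf : Measurable f) :
    ∫ ω, f (fun i => Z (u i) (σ i) ω) ∂P = ∫ ω, f (fun i => Z (v i) (σ i) ω) ∂P := by
  rw [← integral_map (measurable_pi_lambda _ fun i => hm _ _).aemeasurable
      hf.aestronglyMeasurable, hZ.map_eq_of_injective hm hu hv σ,
    integral_map (measurable_pi_lambda _ fun i => hm _ _).aemeasurable hf.aestronglyMeasurable]

/-! ### The directing kernel of an action -/

variable (P Z) in
/-- The conditional distribution of the reward of an action at one step given the rewards of that
action at infinitely many other steps. -/
noncomputable def directingKernel (a : 𝒜) : Kernel (ℕ → ℝ) ℝ :=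
  condDistrib (Z 0 a) (fun ω k => Z (2 * k + 1) a ω) P

instance (a : 𝒜) : IsMarkovKernel (directingKernel P Z a) := by
  unfold directingKernel
  infer_instance

/-- The pair has the same law as for the odd steps and the step `0`, where the identity is the
disintegration that defines the kernel. Both pairs are indexed by `Option ℕ`, with `none` for the
single step. -/
theorem map_compProd_directingKernel (hZ : IsExchangeableArray P Z)
    (hm : ∀ i a, Measurable (Z i a)) (a : 𝒜) {x : ℕ} {e : ℕ → ℕ} (he : e.Injective)
    (hx : ∀ k, e k ≠ x) :
    (P.map fun ω k => Z (e k) a ω) ⊗ₘ directingKernel P Z a =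
      P.map fun ω => (fun k => Z (e k) a ω, Z x a ω) := by
  have hodd : Function.Injective fun k : ℕ => 2 * k + 1 := fun i j h => by simpa using h
  have hinj : ∀ (y : ℕ) (f : ℕ → ℕ), f.Injective → (∀ k, f k ≠ y) →
      Function.Injective fun o : Option ℕ => o.elim y f := fun y f hf hy o o' h => by
    rcases o with _ | o <;> rcases o' with _ | o'
    · rfl
    · exact absurd h.symm (hy o')
    · exact absurd h (hy o)
    · exact congrArg some (hf h)
  have hr : Measurable fun y : Option ℕ → ℝ => ((fun k => y (some k), y none) : (ℕ → ℝ) × ℝ) := by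
    fun_prop
  have h1 := hZ.map_eq_of_injective hm he hodd fun _ => a
  have h2 := congrArg (Measure.map fun y : Option ℕ → ℝ => ((fun k => y (some k), y none) :
      (ℕ → ℝ) × ℝ)) (hZ.map_eq_of_injective hm (hinj x e he hx)
        (hinj 0 (fun k => 2 * k + 1) hodd fun k => by simp) fun _ => a)
  rw [Measure.map_map hr (measurable_pi_lambda _ fun i => hm _ _),
    Measure.map_map hr (measurable_pi_lambda _ fun i => hm _ _)] at h2
  simp only [Function.comp_def, Option.elim] at h2
  rw [h1, h2, directingKernel, compProd_map_condDistrib (hm 0 a).aemeasurable]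

/-- The directing kernel is the conditional distribution of the reward at any step given the rewards
at infinitely many other steps. -/
theorem integral_mul_indicator (hZ : IsExchangeableArray P Z)
    (hm : ∀ i a, Measurable (Z i a)) (a : 𝒜) {x : ℕ} {e : ℕ → ℕ} (he : e.Injective)
    (hx : ∀ k, e k ≠ x) {B : Set ℝ} (hB : MeasurableSet B) {g : (ℕ → ℝ) → ℝ} (hg : Measurable g)
    {c : ℝ} (hgc : ∀ y, |g y| ≤ c) :
    ∫ ω, g (fun k => Z (e k) a ω) * B.indicator 1 (Z x a ω) ∂P =
      ∫ ω, g (fun k => Z (e k) a ω) *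
        (directingKernel P Z a (fun k => Z (e k) a ω)).real B ∂P := by
  have hme : Measurable fun ω k => Z (e k) a ω := measurable_pi_lambda _ fun i => hm _ _
  have hf : Measurable fun p : (ℕ → ℝ) × ℝ => g p.1 * B.indicator (1 : ℝ → ℝ) p.2 :=
    (hg.comp measurable_fst).mul ((measurable_one.indicator hB).comp measurable_snd)
  have hκ : Measurable fun y => (directingKernel P Z a y).real B :=
    (Kernel.measurable_coe _ hB).ennreal_toReal
  have : IsProbabilityMeasure (P.map fun ω k => Z (e k) a ω) :=
    Measure.isProbabilityMeasure_map hme.aemeasurable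
  have h := congrArg (fun μ => ∫ p, g p.1 * B.indicator (1 : ℝ → ℝ) p.2 ∂μ)
    (hZ.map_compProd_directingKernel hm a he hx)
  rw [integral_map (hme.prodMk (hm _ _)).aemeasurable hf.aestronglyMeasurable,
    Measure.integral_compProd] at h
  · rw [← h]
    simp only [integral_const_mul, integral_indicator_one hB]
    exact integral_map (f := fun y => g y * (directingKernel P Z a y).real B) hme.aemeasurable
      (hg.mul hκ).aestronglyMeasurable
  · refine Integrable.of_bound hf.aestronglyMeasurable (c * 1) (ae_of_all _ fun p => ?_)
    rw [norm_mul]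
    have hc : 0 ≤ c := (abs_nonneg _).trans (hgc p.1)
    refine mul_le_mul (hgc _) ?_ (norm_nonneg _) hc
    by_cases hp : p.2 ∈ B <;> simp [hp]

end IsExchangeableArray

/-! ### Empirical frequencies and their `L²` convergence -/

/-- The relative frequency of the event `B` among the first `n` terms of a sequence. -/
noncomputable def frequency (B : Set ℝ) (n : ℕ) (y : ℕ → ℝ) : ℝ :=
  (∑ k ∈ Finset.range n, B.indicator 1 (y k)) / n

theorem measurable_frequency {B : Set ℝ} (hB : MeasurableSet B) (n : ℕ) :
    Measurable (frequency B n) :=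
  (Finset.measurable_fun_sum _ fun k _ =>
    (measurable_one.indicator hB).comp (measurable_pi_apply k)).div_const _

theorem frequency_nonneg (B : Set ℝ) (n : ℕ) (y : ℕ → ℝ) : 0 ≤ frequency B n y :=
  div_nonneg (Finset.sum_nonneg fun _ _ => indicator_nonneg (by simp) _) (Nat.cast_nonneg n)

theorem frequency_le_one (B : Set ℝ) (n : ℕ) (y : ℕ → ℝ) : frequency B n y ≤ 1 := by
  refine div_le_one_of_le₀ ?_ (Nat.cast_nonneg n)
  calc ∑ k ∈ Finset.range n, B.indicator (1 : ℝ → ℝ) (y k) ≤ ∑ k ∈ Finset.range n, 1 :=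
        Finset.sum_le_sum fun k _ => indicator_le_self' (by simp) _
    _ = n := by simp

theorem integrable_of_abs_le {Ω : Type*} [MeasurableSpace Ω] {P : Measure Ω} [IsFiniteMeasure P]
    {f : Ω → ℝ} (hf : Measurable f) {c : ℝ} (hc : ∀ ω, |f ω| ≤ c) : Integrable f P :=
  Integrable.of_bound hf.aestronglyMeasurable c (ae_of_all _ hc)

namespace IsExchangeableArray

variable {𝒜 Ω : Type*} [MeasurableSpace Ω] {P : Measure Ω} [IsProbabilityMeasure P]
  {Z : ℕ → 𝒜 → Ω → ℝ}

/-- Exchanging the steps `e j` and `e' j` preserves the joint law, flips the sign of the first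
factor and fixes the second, so the expectation equals its own negative. -/
theorem integral_mul_sub_indicator_eq_zero (hZ : IsExchangeableArray P Z)
    (hm : ∀ i a, Measurable (Z i a)) (a : 𝒜) {e e' : ℕ → ℕ} (he : e.Injective)
    (he' : e'.Injective) (hd : ∀ i j, e i ≠ e' j) {B : Set ℝ} (hB : MeasurableSet B)
    {j k : ℕ} (hjk : j ≠ k) :
    ∫ ω, (B.indicator (1 : ℝ → ℝ) (Z (e' j) a ω) - B.indicator 1 (Z (e j) a ω)) *
      (B.indicator 1 (Z (e' k) a ω) - B.indicator 1 (Z (e k) a ω)) ∂P = 0 := by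
  have hB1 : Measurable (B.indicator (1 : ℝ → ℝ)) := measurable_one.indicator hB
  have hu : (Sum.elim e' e).Injective := he'.sumElim he fun i j h => hd j i h.symm
  let s : Equiv.Perm (ℕ ⊕ ℕ) := Equiv.swap (.inl j) (.inr j)
  have hf : Measurable fun y : ℕ ⊕ ℕ → ℝ =>
      (B.indicator (1 : ℝ → ℝ) (y (.inl j)) - B.indicator 1 (y (.inr j))) *
        (B.indicator 1 (y (.inl k)) - B.indicator 1 (y (.inr k))) := by
    fun_prop
  have h := hZ.integral_eq_of_injective hm (hu.comp s.injective) hu (fun _ => a) hf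
  have h1 : s (.inl j) = .inr j := Equiv.swap_apply_left _ _
  have h2 : s (.inr j) = .inl j := Equiv.swap_apply_right _ _
  have h3 : s (.inl k) = .inl k :=
    Equiv.swap_apply_of_ne_of_ne (by simpa using hjk.symm) (by simp)
  have h4 : s (.inr k) = .inr k :=
    Equiv.swap_apply_of_ne_of_ne (by simp) (by simpa using hjk.symm)
  simp only [Function.comp_apply, h1, h2, h3, h4, Sum.elim_inl, Sum.elim_inr] at h
  have h5 : ∀ x y z : ℝ, (x - y) * z = -((y - x) * z) := fun x y z => by ring
  have h6 : ∫ ω, (B.indicator (1 : ℝ → ℝ) (Z (e j) a ω) - B.indicator 1 (Z (e' j) a ω)) *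
      (B.indicator 1 (Z (e' k) a ω) - B.indicator 1 (Z (e k) a ω)) ∂P =
      -∫ ω, (B.indicator (1 : ℝ → ℝ) (Z (e' j) a ω) - B.indicator 1 (Z (e j) a ω)) *
      (B.indicator 1 (Z (e' k) a ω) - B.indicator 1 (Z (e k) a ω)) ∂P := by
    rw [← integral_neg]
    exact integral_congr_ae (ae_of_all _ fun ω => h5 _ _ _)
  linarith

/-- In the expanded square the off-diagonal terms vanish, and the `n` diagonal terms are at most `1`
each, against the denominator `n ^ 2`. -/
theorem integral_sq_frequency_sub_frequency_le (hZ : IsExchangeableArray P Z)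
    (hm : ∀ i a, Measurable (Z i a)) (a : 𝒜) {e e' : ℕ → ℕ} (he : e.Injective)
    (he' : e'.Injective) (hd : ∀ i j, e i ≠ e' j) {B : Set ℝ} (hB : MeasurableSet B) (n : ℕ) :
    ∫ ω, (frequency B n (fun k => Z (e' k) a ω) - frequency B n (fun k => Z (e k) a ω)) ^ 2 ∂P ≤
      1 / n := by
  rcases Nat.eq_zero_or_pos n with rfl | hn
  · simp [frequency]
  have hn' : (0 : ℝ) < n := Nat.cast_pos.2 hn
  let D : ℕ → Ω → ℝ := fun k ω =>
    B.indicator (1 : ℝ → ℝ) (Z (e' k) a ω) - B.indicator 1 (Z (e k) a ω)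
  have hB1 : Measurable (B.indicator (1 : ℝ → ℝ)) := measurable_one.indicator hB
  have hDm : ∀ k, Measurable (D k) := fun k =>
    (hB1.comp (hm _ _)).sub (hB1.comp (hm _ _))
  have hD1 : ∀ k ω, |D k ω| ≤ 1 := fun k ω => by
    by_cases h1 : Z (e' k) a ω ∈ B <;> by_cases h2 : Z (e k) a ω ∈ B <;> simp [D, h1, h2]
  have hDD1 : ∀ j k ω, |D j ω * D k ω| ≤ 1 := fun j k ω => by
    rw [abs_mul]
    exact mul_le_one₀ (hD1 j ω) (abs_nonneg _) (hD1 k ω)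
  have hDi : ∀ j k, Integrable (fun ω => D j ω * D k ω) P := fun j k =>
    integrable_of_abs_le ((hDm j).mul (hDm k)) (hDD1 j k)
  have hsq : ∀ ω,
      (frequency B n (fun k => Z (e' k) a ω) - frequency B n (fun k => Z (e k) a ω)) ^ 2 =
        (∑ j ∈ Finset.range n, ∑ k ∈ Finset.range n, D j ω * D k ω) / n ^ 2 := fun ω => by
    rw [← Finset.sum_mul_sum, Finset.sum_sub_distrib, frequency, frequency]
    ring
  have hint : ∀ j ∈ Finset.range n,
      ∫ ω, ∑ k ∈ Finset.range n, D j ω * D k ω ∂P ≤ 1 := fun j hj => by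
    rw [integral_finsetSum _ fun k _ => hDi j k, Finset.sum_eq_single_of_mem j hj fun k _ hk =>
      hZ.integral_mul_sub_indicator_eq_zero hm a he he' hd hB hk.symm]
    calc ∫ ω, D j ω * D j ω ∂P ≤ ∫ _, 1 ∂P :=
          integral_mono (hDi j j) (integrable_const _) fun ω => (abs_le.1 (hDD1 j j ω)).2
      _ = 1 := by simp
  simp only [hsq]
  rw [integral_div, integral_finsetSum _ fun j _ => integrable_finsetSum _ fun k _ => hDi j k]
  calc (∑ j ∈ Finset.range n, ∫ ω, ∑ k ∈ Finset.range n, D j ω * D k ω ∂P) / (n : ℝ) ^ 2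
      ≤ (∑ j ∈ Finset.range n, (1 : ℝ)) / (n : ℝ) ^ 2 := by
        gcongr with j hj
        exact hint j hj
    _ = 1 / (n : ℝ) := by
        simp only [Finset.sum_const, Finset.card_range, nsmul_eq_mul, mul_one]
        field_simp

theorem integral_mul_frequency (hZ : IsExchangeableArray P Z)
    (hm : ∀ i a, Measurable (Z i a)) (a : 𝒜) {e e' : ℕ → ℕ} (he : e.Injective)
    (hd : ∀ i j, e i ≠ e' j) {B : Set ℝ} (hB : MeasurableSet B) {n : ℕ} (hn : n ≠ 0)
    {g : (ℕ → ℝ) → ℝ} (hg : Measurable g) {c : ℝ} (hgc : ∀ y, |g y| ≤ c) :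
    ∫ ω, g (fun k => Z (e k) a ω) * frequency B n (fun k => Z (e' k) a ω) ∂P =
      ∫ ω, g (fun k => Z (e k) a ω) *
        (directingKernel P Z a (fun k => Z (e k) a ω)).real B ∂P := by
  have hg' : Measurable fun ω => g (fun k => Z (e k) a ω) :=
    hg.comp (measurable_pi_lambda _ fun k => hm _ _)
  have hi : ∀ k, Integrable (fun ω => g (fun k => Z (e k) a ω) *
      B.indicator (1 : ℝ → ℝ) (Z (e' k) a ω)) P := fun k => by
    refine integrable_of_abs_le (c := c)
      (hg'.mul ((measurable_one.indicator hB).comp (hm _ _))) fun ω => ?_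
    rw [abs_mul]
    refine (mul_le_of_le_one_right (abs_nonneg _) ?_).trans (hgc _)
    by_cases h : Z (e' k) a ω ∈ B <;> simp [h]
  simp only [frequency, mul_div_assoc', Finset.mul_sum]
  rw [integral_div, integral_finsetSum _ fun k _ => hi k,
    Finset.sum_congr rfl fun k _ => hZ.integral_mul_indicator hm a he (fun i => hd i k) hB hg hgc]
  simp [hn]

/-- The frequencies converge in `L²` to the directing kernel. -/
theorem integral_sq_frequency_sub_directingKernel_le (hZ : IsExchangeableArray P Z)
    (hm : ∀ i a, Measurable (Z i a)) (a : 𝒜) {e e' : ℕ → ℕ} (he : e.Injective)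
    (he' : e'.Injective) (hd : ∀ i j, e i ≠ e' j) {B : Set ℝ} (hB : MeasurableSet B) {n : ℕ}
    (hn : n ≠ 0) :
    ∫ ω, (frequency B n (fun k => Z (e' k) a ω) -
      (directingKernel P Z a (fun k => Z (e k) a ω)).real B) ^ 2 ∂P ≤ 1 / n := by
  refine le_trans ?_ (hZ.integral_sq_frequency_sub_frequency_le hm a he he' hd hB n)
  let κ : (ℕ → ℝ) → ℝ := fun y => (directingKernel P Z a y).real B
  have hκ : Measurable κ := (Kernel.measurable_coe _ hB).ennreal_toReal
  have hκ0 : ∀ y, 0 ≤ κ y := fun y => measureReal_nonneg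
  have hκ1 : ∀ y, κ y ≤ 1 := fun y => measureReal_le_one
  let g : (ℕ → ℝ) → ℝ := fun y => κ y - frequency B n y
  have hg : Measurable g := hκ.sub (measurable_frequency hB n)
  have hg1 : ∀ y, |g y| ≤ 1 := fun y =>
    abs_sub_le_iff.2 ⟨by linarith [hκ1 y, frequency_nonneg B n y],
      by linarith [hκ0 y, frequency_le_one B n y]⟩
  have hme : ∀ e : ℕ → ℕ, Measurable fun ω k => Z (e k) a ω := fun e =>
    measurable_pi_lambda _ fun k => hm _ _
  let V : Ω → ℝ := fun ω => frequency B n fun k => Z (e' k) a ω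
  let G : Ω → ℝ := fun ω => g fun k => Z (e k) a ω
  let K : Ω → ℝ := fun ω => κ fun k => Z (e k) a ω
  have hV : Measurable V := (measurable_frequency hB n).comp (hme e')
  have hG : Measurable G := hg.comp (hme e)
  have hK : Measurable K := hκ.comp (hme e)
  have hV1 : ∀ ω, |V ω| ≤ 1 := fun ω =>
    abs_le.2 ⟨by linarith [frequency_nonneg B n fun k => Z (e' k) a ω], frequency_le_one B n _⟩
  have hK1 : ∀ ω, |K ω| ≤ 1 := fun ω =>
    abs_le.2 ⟨by linarith [hκ0 fun k => Z (e k) a ω], hκ1 _⟩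
  have hprod : ∀ X : Ω → ℝ, Measurable X → (∀ ω, |X ω| ≤ 1) →
      Integrable (fun ω => G ω * X ω) P := fun X hX hX1 =>
    integrable_of_abs_le (c := 1) (hG.mul hX) fun ω => by
      rw [abs_mul]
      exact mul_le_one₀ (hg1 _) (abs_nonneg _) (hX1 ω)
  have hVK1 : ∀ ω, |V ω - K ω| ≤ 1 := fun ω =>
    abs_sub_le_iff.2 ⟨by linarith [hκ0 fun k => Z (e k) a ω, (abs_le.1 (hV1 ω)).2],
      by linarith [frequency_nonneg B n fun k => Z (e' k) a ω, (abs_le.1 (hK1 ω)).2]⟩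
  have hVK : Integrable (fun ω => (V ω - K ω) ^ 2) P :=
    integrable_of_abs_le (c := 1) ((hV.sub hK).pow_const 2) fun ω => by
      rw [abs_pow]
      exact pow_le_one₀ (abs_nonneg _) (hVK1 ω)
  -- `K` is the conditional expectation of `V` given the rewards along `e`, so `V - K` is orthogonal
  -- to `G`, a function of those rewards. As `V - K + G` is the difference of the two frequencies,
  -- Pythagoras gives the bound.
  have h0 : ∫ ω, G ω * (V ω - K ω) ∂P = 0 := by
    simp only [mul_sub]
    rw [integral_sub (hprod V hV hV1) (hprod K hK hK1), sub_eq_zero]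
    exact hZ.integral_mul_frequency hm a he hd hB hn hg hg1
  have hle : ∀ ω, (V ω - K ω) ^ 2 + 2 * (G ω * (V ω - K ω)) ≤
      (V ω - frequency B n (fun k => Z (e k) a ω)) ^ 2 := fun ω => by
    have : V ω - frequency B n (fun k => Z (e k) a ω) = (V ω - K ω) + G ω := by
      simp only [G, g, K]
      ring
    rw [this]
    nlinarith [sq_nonneg (G ω)]
  have hGVK := hprod (fun ω => V ω - K ω) (hV.sub hK) hVK1
  calc ∫ ω, (V ω - K ω) ^ 2 ∂P = ∫ ω, ((V ω - K ω) ^ 2 + 2 * (G ω * (V ω - K ω))) ∂P := by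
        rw [integral_add hVK (hGVK.const_mul 2), integral_const_mul, h0]
        simp
    _ ≤ _ := by
        refine integral_mono (hVK.add (hGVK.const_mul 2)) (integrable_of_abs_le (c := 1)
          ((hV.sub ((measurable_frequency hB n).comp (hme e))).pow_const 2) fun ω => ?_) hle
        rw [abs_pow]
        refine pow_le_one₀ (abs_nonneg _) (abs_sub_le_iff.2 ⟨?_, ?_⟩)
        · linarith [(abs_le.1 (hV1 ω)).2, frequency_nonneg B n fun k => Z (e k) a ω]
        · linarith [frequency_nonneg B n fun k => Z (e' k) a ω,
            frequency_le_one B n fun k => Z (e k) a ω]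

end IsExchangeableArray

/-! ### Recomputing the directing kernel and replacing rewards by it -/

theorem eq_zero_of_forall_sq_le_inv {x c : ℝ} (h : ∀ n : ℕ, n ≠ 0 → x ^ 2 ≤ c / n) : x = 0 := by
  have hlim : Tendsto (fun n : ℕ => c / n) atTop (𝓝 0) := tendsto_const_div_atTop_nhds_zero_nat c
  have hx : x ^ 2 ≤ 0 := ge_of_tendsto hlim <| by
    filter_upwards [eventually_ne_atTop 0] with n hn using h n hn
  exact pow_eq_zero_iff two_ne_zero |>.1 (le_antisymm hx (sq_nonneg x))

theorem sq_integral_le_integral_sq {Ω : Type*} [MeasurableSpace Ω] {P : Measure Ω}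
    [IsProbabilityMeasure P] {f : Ω → ℝ} (hf : Integrable f P)
    (hf2 : Integrable (fun ω => f ω ^ 2) P) : (∫ ω, f ω ∂P) ^ 2 ≤ ∫ ω, f ω ^ 2 ∂P := by
  let c := ∫ ω, f ω ∂P
  have hc : Integrable (fun ω => 2 * c * f ω) P := hf.const_mul _
  have h : 0 ≤ ∫ ω, (f ω - c) ^ 2 ∂P := integral_nonneg fun ω => sq_nonneg _
  have hsq : ∀ ω, (f ω - c) ^ 2 = f ω ^ 2 - (2 * c * f ω - c ^ 2) := fun ω => by ring
  simp only [hsq] at h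
  have hc' : Integrable (fun ω => 2 * c * f ω - c ^ 2) P := hc.sub (integrable_const _)
  rw [integral_sub hf2 hc', integral_sub hc (integrable_const _),
    integral_const_mul] at h
  simp only [integral_const, probReal_univ, one_smul] at h
  change c ^ 2 ≤ _
  linarith [show 2 * c * ∫ ω, f ω ∂P = 2 * c ^ 2 by simp only [c]; ring]

namespace IsExchangeableArray

variable {𝒜 Ω : Type*} [MeasurableSpace Ω] {P : Measure Ω} [IsProbabilityMeasure P]
  {Z : ℕ → 𝒜 → Ω → ℝ}

theorem measurable_directingKernel_real (hm : ∀ i a, Measurable (Z i a)) (a : 𝒜) (e : ℕ → ℕ)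
    {B : Set ℝ} (hB : MeasurableSet B) :
    Measurable fun ω => (directingKernel P Z a (fun k => Z (e k) a ω)).real B :=
  (Kernel.measurable_coe _ hB).ennreal_toReal.comp (measurable_pi_lambda _ fun _ => hm _ _)

theorem measurable_frequency_comp (hm : ∀ i a, Measurable (Z i a)) (a : 𝒜) (e : ℕ → ℕ)
    {B : Set ℝ} (hB : MeasurableSet B) (n : ℕ) :
    Measurable fun ω => frequency B n (fun k => Z (e k) a ω) :=
  (measurable_frequency hB n).comp (measurable_pi_lambda _ fun _ => hm _ _)

theorem abs_frequency_sub_directingKernel_le (a : 𝒜) (B : Set ℝ) (n : ℕ) (y z : ℕ → ℝ) :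
    |frequency B n y - (directingKernel P Z a z).real B| ≤ 1 := by
  have h0 : 0 ≤ (directingKernel P Z a z).real B := measureReal_nonneg
  have h1 : (directingKernel P Z a z).real B ≤ 1 := measureReal_le_one
  exact abs_sub_le_iff.2 ⟨by linarith [frequency_le_one B n y],
    by linarith [frequency_nonneg B n y]⟩

theorem integrable_sq_frequency_sub_directingKernel (hm : ∀ i a, Measurable (Z i a)) (a : 𝒜)
    (e e' : ℕ → ℕ) {B : Set ℝ} (hB : MeasurableSet B) (n : ℕ) :
    Integrable (fun ω => (frequency B n (fun k => Z (e' k) a ω) -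
      (directingKernel P Z a (fun k => Z (e k) a ω)).real B) ^ 2) P :=
  integrable_of_abs_le (c := 1) (((measurable_frequency_comp hm a e' hB n).sub
    (measurable_directingKernel_real hm a e hB)).pow_const 2) fun ω => by
      rw [abs_pow]
      exact pow_le_one₀ (abs_nonneg _) (abs_frequency_sub_directingKernel_le a B n _ _)

/-- Both sides are `L²` limits of the same frequencies along `d`. The auxiliary sequence `d` allows
`e` and `e'` to overlap. -/
theorem directingKernel_real_ae_eq (hZ : IsExchangeableArray P Z)
    (hm : ∀ i a, Measurable (Z i a)) (a : 𝒜) {e e' d : ℕ → ℕ} (he : e.Injective)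
    (he' : e'.Injective) (hdinj : d.Injective) (hd : ∀ i j, e i ≠ d j) (hd' : ∀ i j, e' i ≠ d j)
    {B : Set ℝ} (hB : MeasurableSet B) :
    ∀ᵐ ω ∂P, (directingKernel P Z a (fun k => Z (e k) a ω)).real B =
      (directingKernel P Z a (fun k => Z (e' k) a ω)).real B := by
  let K : (ℕ → ℕ) → Ω → ℝ := fun e ω => (directingKernel P Z a (fun k => Z (e k) a ω)).real B
  have hK : ∀ e, Measurable (K e) := fun e => measurable_directingKernel_real hm a e hB
  have hKi : Integrable (fun ω => (K e ω - K e' ω) ^ 2) P :=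
    integrable_of_abs_le (c := 1) (((hK e).sub (hK e')).pow_const 2) fun ω => by
      have h0 : ∀ e, 0 ≤ K e ω := fun e => measureReal_nonneg
      have h1 : ∀ e, K e ω ≤ 1 := fun e => measureReal_le_one
      rw [abs_pow]
      exact pow_le_one₀ (abs_nonneg _)
        (abs_sub_le_iff.2 ⟨by linarith [h0 e', h1 e], by linarith [h0 e, h1 e']⟩)
  have hle : ∀ n : ℕ, n ≠ 0 → ∫ ω, (K e ω - K e' ω) ^ 2 ∂P ≤ 4 / n := fun n hn => by
    have h1 := hZ.integral_sq_frequency_sub_directingKernel_le hm a he hdinj hd hB hn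
    have h2 := hZ.integral_sq_frequency_sub_directingKernel_le hm a he' hdinj hd' hB hn
    have i1 := integrable_sq_frequency_sub_directingKernel (P := P) hm a e d hB n
    have i2 := integrable_sq_frequency_sub_directingKernel (P := P) hm a e' d hB n
    calc ∫ ω, (K e ω - K e' ω) ^ 2 ∂P
        ≤ ∫ ω, (2 * (frequency B n (fun k => Z (d k) a ω) - K e ω) ^ 2 +
          2 * (frequency B n (fun k => Z (d k) a ω) - K e' ω) ^ 2) ∂P := by
          refine integral_mono hKi ((i1.const_mul 2).add (i2.const_mul 2)) fun ω => ?_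
          simp only
          nlinarith [sq_nonneg ((frequency B n (fun k => Z (d k) a ω) - K e ω) +
            (frequency B n (fun k => Z (d k) a ω) - K e' ω))]
      _ ≤ 2 * (1 / n) + 2 * (1 / n) := by
          rw [integral_add (i1.const_mul 2) (i2.const_mul 2), integral_const_mul,
            integral_const_mul]
          gcongr
      _ = 4 / n := by ring
  have h0 : ∫ ω, (K e ω - K e' ω) ^ 2 ∂P = 0 := by
    refine le_antisymm ?_ (integral_nonneg fun ω => sq_nonneg _)
    refine ge_of_tendsto (tendsto_const_div_atTop_nhds_zero_nat 4) ?_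
    filter_upwards [eventually_ne_atTop 0] with n hn using hle n hn
  rw [integral_eq_zero_iff_of_nonneg (fun ω => sq_nonneg _) hKi] at h0
  filter_upwards [h0] with ω hω
  exact sub_eq_zero.1 ((pow_eq_zero_iff two_ne_zero).1 hω)

/-- The exceptional null set for one Borel set depends on that set; the countably many rational
intervals suffice to determine the measure. -/
theorem directingKernel_ae_eq (hZ : IsExchangeableArray P Z)
    (hm : ∀ i a, Measurable (Z i a)) (a : 𝒜) {e e' d : ℕ → ℕ} (he : e.Injective)
    (he' : e'.Injective) (hdinj : d.Injective) (hd : ∀ i j, e i ≠ d j)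
    (hd' : ∀ i j, e' i ≠ d j) :
    ∀ᵐ ω ∂P, directingKernel P Z a (fun k => Z (e k) a ω) =
      directingKernel P Z a (fun k => Z (e' k) a ω) := by
  have h : ∀ᵐ ω ∂P, ∀ p q : ℚ, (directingKernel P Z a (fun k => Z (e k) a ω)).real (Ioo p q) =
      (directingKernel P Z a (fun k => Z (e' k) a ω)).real (Ioo p q) :=
    ae_all_iff.2 fun p => ae_all_iff.2 fun q =>
      hZ.directingKernel_real_ae_eq hm a he he' hdinj hd hd' measurableSet_Ioo
  filter_upwards [h] with ω hω
  exact Real.measure_ext_Ioo_rat fun p q => (measureReal_eq_measureReal_iff).1 (hω p q)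

/-- The reward of an action at a further step may be replaced in expectations by the probability
under the directing measure. -/
theorem integral_mul_indicator_eq_directing (hZ : IsExchangeableArray P Z)
    (hm : ∀ i a, Measurable (Z i a)) {ι : Type*} {v : ι → ℕ} (hv : v.Injective) (σ : ι → 𝒜)
    {x : ℕ} (hx : ∀ i, v i ≠ x) (a : 𝒜) {e w : ℕ → ℕ} (he : e.Injective) (hw : w.Injective)
    (hew : ∀ i j, e i ≠ w j) (hvw : ∀ i j, v i ≠ w j) {B : Set ℝ} (hB : MeasurableSet B)
    {q : (ι → ℝ) → ℝ} (hq : Measurable q) (hq1 : ∀ y, |q y| ≤ 1) :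
    ∫ ω, q (fun i => Z (v i) (σ i) ω) * B.indicator 1 (Z x a ω) ∂P =
      ∫ ω, q (fun i => Z (v i) (σ i) ω) *
        (directingKernel P Z a (fun k => Z (e k) a ω)).real B ∂P := by
  have hB1 : Measurable (B.indicator (1 : ℝ → ℝ)) := measurable_one.indicator hB
  have hBle : ∀ y, |B.indicator (1 : ℝ → ℝ) y| ≤ 1 := fun y => by
    by_cases h : y ∈ B <;> simp [h]
  let Q : Ω → ℝ := fun ω => q fun i => Z (v i) (σ i) ω
  let K : Ω → ℝ := fun ω => (directingKernel P Z a (fun k => Z (e k) a ω)).real B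
  have hK : Measurable K := measurable_directingKernel_real hm a e hB
  have hQ : Measurable Q := hq.comp (measurable_pi_lambda _ fun i => hm _ _)
  have hQ1 : ∀ ω, |Q ω| ≤ 1 := fun ω => hq1 _
  have hint : ∀ X : Ω → ℝ, Measurable X → (∀ ω, |X ω| ≤ 1) → Integrable (fun ω => Q ω * X ω) P :=
    fun X hX hX1 => integrable_of_abs_le (c := 1) (hQ.mul hX) fun ω => by
      rw [abs_mul]
      exact mul_le_one₀ (hQ1 ω) (abs_nonneg _) (hX1 ω)
  have hK1 : ∀ ω, |K ω| ≤ 1 := fun ω => by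
    rw [abs_of_nonneg measureReal_nonneg]
    exact measureReal_le_one
  have hinj : ∀ y : ℕ, (∀ i, v i ≠ y) → Function.Injective fun o : Option ι => o.elim y v :=
    fun y hy o o' h => by
      rcases o with _ | o <;> rcases o' with _ | o'
      · rfl
      · exact absurd h.symm (hy o')
      · exact absurd h (hy o)
      · exact congrArg some (hv h)
  -- The steps `x` and `w k` both lie off the range of `v`, so moving the reward from one to the
  -- other preserves the joint law.
  have hswap : ∀ k, ∫ ω, Q ω * B.indicator 1 (Z (w k) a ω) ∂P =
      ∫ ω, Q ω * B.indicator 1 (Z x a ω) ∂P := fun k => by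
    have hf : Measurable fun y : Option ι → ℝ =>
        q (fun i => y (some i)) * B.indicator (1 : ℝ → ℝ) (y none) := by
      fun_prop
    exact hZ.integral_eq_of_injective hm (hinj (w k) fun i => hvw i k) (hinj x hx)
      (fun o => o.elim a σ) hf
  have havg : ∀ n : ℕ, n ≠ 0 → ∫ ω, Q ω * frequency B n (fun k => Z (w k) a ω) ∂P =
      ∫ ω, Q ω * B.indicator 1 (Z x a ω) ∂P := fun n hn => by
    simp only [frequency, mul_div_assoc', Finset.mul_sum]
    rw [integral_div, integral_finsetSum _ fun k _ =>
        hint (fun ω => B.indicator 1 (Z (w k) a ω)) (hB1.comp (hm _ _)) fun ω => hBle _,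
      Finset.sum_congr rfl fun k _ => hswap k]
    simp [hn]
  -- The error is the integral of `Q` times frequency minus `K`, controlled by Jensen and the `L²`
  -- bound. That bound concerns the action `a` alone, so `e` may meet `v` or contain `x`.
  refine sub_eq_zero.1 (eq_zero_of_forall_sq_le_inv (c := 1) fun n hn => ?_)
  have hA : Measurable fun ω => frequency B n (fun k => Z (w k) a ω) :=
    measurable_frequency_comp hm a w hB n
  have hA1 : ∀ ω, |frequency B n (fun k => Z (w k) a ω)| ≤ 1 := fun ω => by
    rw [abs_of_nonneg (frequency_nonneg _ _ _)]
    exact frequency_le_one _ _ _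
  have hAK1 : ∀ ω, |frequency B n (fun k => Z (w k) a ω) - K ω| ≤ 1 := fun ω =>
    abs_frequency_sub_directingKernel_le a B n _ _
  have hsq_le : ∀ ω, (Q ω * (frequency B n (fun k => Z (w k) a ω) - K ω)) ^ 2 ≤
      (frequency B n (fun k => Z (w k) a ω) - K ω) ^ 2 := fun ω => by
    rw [mul_pow]
    exact mul_le_of_le_one_left (sq_nonneg _) ((sq_le_one_iff_abs_le_one _).2 (hQ1 ω))
  have hsqi : Integrable (fun ω => (Q ω * (frequency B n (fun k => Z (w k) a ω) - K ω)) ^ 2) P :=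
    integrable_of_abs_le (c := 1) ((hQ.mul (hA.sub hK)).pow_const 2) fun ω => by
      rw [abs_of_nonneg (sq_nonneg _)]
      exact (hsq_le ω).trans ((sq_le_one_iff_abs_le_one _).2 (hAK1 ω))
  rw [← havg n hn]
  change (_ - ∫ ω, Q ω * K ω ∂P) ^ 2 ≤ _
  rw [← integral_sub (hint _ hA hA1) (hint _ hK hK1)]
  simp only [← mul_sub]
  calc (∫ ω, Q ω * (frequency B n (fun k => Z (w k) a ω) - K ω) ∂P) ^ 2
      ≤ ∫ ω, (Q ω * (frequency B n (fun k => Z (w k) a ω) - K ω)) ^ 2 ∂P :=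
        sq_integral_le_integral_sq (hint _ (hA.sub hK) hAK1) hsqi
    _ ≤ ∫ ω, (frequency B n (fun k => Z (w k) a ω) - K ω) ^ 2 ∂P :=
        integral_mono hsqi (integrable_sq_frequency_sub_directingKernel hm a e w hB n) hsq_le
    _ ≤ 1 / n := hZ.integral_sq_frequency_sub_directingKernel_le hm a he hw hew hB hn

end IsExchangeableArray

/-! ### Conditional law of the rewards given the directing measures -/

namespace IsExchangeableArray

variable {𝒜 Ω : Type*} [MeasurableSpace Ω] {P : Measure Ω} [IsProbabilityMeasure P]
  {Z : ℕ → 𝒜 → Ω → ℝ}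

variable (P Z) in
/-- The random measures that direct the rewards of the actions. -/
noncomputable def directingMeasure (ω : Ω) (a : 𝒜) : ProbabilityMeasure ℝ :=
  ⟨directingKernel P Z a fun k => Z (2 * k + 1) a ω, inferInstance⟩

theorem measurable_directingMeasure (hm : ∀ i a, Measurable (Z i a)) :
    Measurable (directingMeasure P Z) :=
  measurable_pi_lambda _ fun a => Measurable.subtype_mk <|
    (directingKernel P Z a).measurable.comp (measurable_pi_lambda _ fun _ => hm _ _)

theorem measurable_apply_probabilityMeasure (a : 𝒜) {B : Set ℝ} (hB : MeasurableSet B) :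
    Measurable fun f : 𝒜 → ProbabilityMeasure ℝ => (f a : Measure ℝ) B :=
  (Measure.measurable_coe hB).comp (measurable_subtype_coe.comp (measurable_pi_apply a))

theorem measurableSet_biInter_reward (hm : ∀ i a, Measurable (Z i a)) {ι : Type*} (u : ι → ℕ)
    (σ : ι → 𝒜) {B : ι → Set ℝ} (hB : ∀ i, MeasurableSet (B i)) (s : Finset ι) :
    MeasurableSet (⋂ i ∈ s, Z (u i) (σ i) ⁻¹' B i) :=
  s.measurableSet_biInter fun i _ => hm _ _ (hB i)

/-- The directing measures all read the odd steps, where different actions collide with each other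
and with `u`. Almost surely they can be recomputed from steps of their own; the conditioning event
then involves rewards at distinct steps only, and the replacement of the reward at `u j` applies. -/
theorem measureReal_inter_reward (hZ : IsExchangeableArray P Z) (hm : ∀ i a, Measurable (Z i a))
    {ι : Type*} {u : ι → ℕ} (hu : u.Injective) (σ : ι → 𝒜) {B : ι → Set ℝ}
    (hB : ∀ i, MeasurableSet (B i)) {s : Finset ι} {j : ι} (hj : j ∉ s) (I : Finset 𝒜)
    {C : Set (I → ProbabilityMeasure ℝ)} (hC : MeasurableSet C) :
    P.real (((⋂ i ∈ s, Z (u i) (σ i) ⁻¹' B i) ∩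
      {ω | I.restrict (directingMeasure P Z ω) ∈ C}) ∩ Z (u j) (σ j) ⁻¹' B j) =
    ∫ ω in (⋂ i ∈ s, Z (u i) (σ i) ⁻¹' B i) ∩ {ω | I.restrict (directingMeasure P Z ω) ∈ C},
      (directingMeasure P Z ω (σ j) : Measure ℝ).real (B j) ∂P := by
  classical
  obtain ⟨N, hN⟩ : ∃ N, ∀ i ∈ insert j s, u i < N :=
    ⟨(insert j s).sup u + 1, fun i hi => Nat.lt_succ_of_le (Finset.le_sup hi)⟩
  -- The steps are separated modulo `4`: multiples of `4` recompute the measures, with one step for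
  -- each pair in `I × ℕ`, the residue `2` serves for averaging, and the odd steps define the
  -- measures. The shift by `N` clears the steps `u i`.
  obtain ⟨c, hc⟩ := exists_injective_nat (I × ℕ)
  let e : I → ℕ → ℕ := fun a k => 4 * (c (a, k) + N)
  let v : s ⊕ (I × ℕ) → ℕ := Sum.elim (fun i => u i) fun p => 4 * (c p + N)
  let ρ : s ⊕ (I × ℕ) → 𝒜 := Sum.elim (fun i => σ i) fun p => p.1
  have hsN : ∀ i : s, u i < N := fun i => hN i (Finset.mem_insert_of_mem i.2)
  have hjN : u j < N := hN j (Finset.mem_insert_self j s)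
  have hv : v.Injective := by
    refine (hu.comp Subtype.val_injective).sumElim (fun p q h => hc (by simpa using h)) ?_
    intro i p h
    have := hsN i
    simp only [Function.comp_apply] at h
    omega
  have hvj : ∀ i, v i ≠ u j := by
    rintro (i | p) h
    · exact hj (hu h ▸ i.2)
    · simp only [v, Sum.elim_inr] at h
      omega
  have hvw : ∀ i k, v i ≠ 4 * (k + N) + 2 := by
    rintro (i | p) k h
    · have := hsN i
      simp only [v, Sum.elim_inl] at h
      omega
    · simp only [v, Sum.elim_inr] at h
      omega
  let Φ : (s ⊕ (I × ℕ) → ℝ) → I → ProbabilityMeasure ℝ := fun y a =>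
    ⟨directingKernel P Z a fun k => y (.inr (a, k)), inferInstance⟩
  have hΦ : Measurable Φ := measurable_pi_lambda _ fun a => Measurable.subtype_mk <|
    (directingKernel P Z (a : 𝒜)).measurable.comp (by fun_prop)
  let S : Set (s ⊕ (I × ℕ) → ℝ) := (⋂ i : s, {y | y (.inl i) ∈ B i}) ∩ Φ ⁻¹' C
  have hS : MeasurableSet S := (MeasurableSet.iInter fun i : s =>
    (measurable_pi_apply (Sum.inl i : s ⊕ (I × ℕ))) (hB i)).inter (hΦ hC)
  have hq1 : ∀ y, |S.indicator (1 : (s ⊕ (I × ℕ) → ℝ) → ℝ) y| ≤ 1 := fun y => by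
    by_cases h : y ∈ S <;> simp [h]
  have key := hZ.integral_mul_indicator_eq_directing hm hv ρ hvj (σ j)
    (e := fun k => 2 * k + 1) (w := fun k => 4 * (k + N) + 2)
    (fun _ _ h => by simpa using h) (fun _ _ h => by simpa using h)
    (fun _ _ h => by omega) hvw (hB j) (measurable_one.indicator hS) hq1
  let E : Set Ω := (⋂ i ∈ s, Z (u i) (σ i) ⁻¹' B i) ∩
    {ω | I.restrict (directingMeasure P Z ω) ∈ C}
  have hE : MeasurableSet E := (measurableSet_biInter_reward hm u σ hB s).inter
    (((Finset.measurable_restrict I).comp (measurable_directingMeasure hm)) hC)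
  have hagree : ∀ᵐ ω ∂P, ∀ a : I, directingKernel P Z (a : 𝒜) (fun k => Z (e a k) a ω) =
      directingKernel P Z (a : 𝒜) (fun k => Z (2 * k + 1) a ω) :=
    ae_all_iff.2 fun a => hZ.directingKernel_ae_eq hm a (e := e a) (e' := fun k => 2 * k + 1)
      (d := fun k => 4 * k + 2)
      (fun k l h => by simpa using hc (by simpa [e] using h : c (a, k) = c (a, l)))
      (fun _ _ h => by simpa using h) (fun _ _ h => by simpa using h)
      (fun _ _ h => by simp only [e] at h; omega) (fun _ _ h => by omega)
  have hind : ∀ᵐ ω ∂P, S.indicator (1 : (s ⊕ (I × ℕ) → ℝ) → ℝ) (fun i => Z (v i) (ρ i) ω) =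
      E.indicator 1 ω := by
    filter_upwards [hagree] with ω hω
    have hΦω : Φ (fun i => Z (v i) (ρ i) ω) = I.restrict (directingMeasure P Z ω) :=
      funext fun a => Subtype.ext (hω a)
    have hiff : (fun i => Z (v i) (ρ i) ω) ∈ S ↔ ω ∈ E := by
      simp only [S, E, mem_inter_iff, mem_iInter, mem_preimage, mem_ofPred_eq, hΦω]
      simp [v, ρ]
    by_cases h : ω ∈ E
    · rw [indicator_of_mem h, indicator_of_mem (hiff.2 h)]
      rfl
    · rw [indicator_of_notMem h, indicator_of_notMem fun h' => h (hiff.1 h')]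
  have hl : ∫ ω, S.indicator (1 : (s ⊕ (I × ℕ) → ℝ) → ℝ) (fun i => Z (v i) (ρ i) ω) *
      (B j).indicator 1 (Z (u j) (σ j) ω) ∂P = P.real (E ∩ Z (u j) (σ j) ⁻¹' B j) := by
    rw [← integral_indicator_one (hE.inter (hm _ _ (hB j)))]
    refine integral_congr_ae ?_
    filter_upwards [hind] with ω hω
    rw [hω, inter_indicator_one (s := E)]
    rfl
  have hr : ∫ ω, S.indicator (1 : (s ⊕ (I × ℕ) → ℝ) → ℝ) (fun i => Z (v i) (ρ i) ω) *
      (directingKernel P Z (σ j) (fun k => Z (2 * k + 1) (σ j) ω)).real (B j) ∂P =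
        ∫ ω in E, (directingMeasure P Z ω (σ j) : Measure ℝ).real (B j) ∂P := by
    rw [← integral_indicator hE]
    refine integral_congr_ae ?_
    filter_upwards [hind] with ω hω
    rw [hω]
    by_cases h : ω ∈ E <;> simp [h, directingMeasure]
  rw [← hl, key, hr]

/-- A finite measure on the product `σ`-algebra is determined by its restrictions to finitely many
actions, even for uncountable `𝒜`; there the identity is `measureReal_inter_reward`. -/
theorem map_restrict_inter_reward (hZ : IsExchangeableArray P Z)
    (hm : ∀ i a, Measurable (Z i a)) {ι : Type*} {u : ι → ℕ} (hu : u.Injective) (σ : ι → 𝒜)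
    {B : ι → Set ℝ} (hB : ∀ i, MeasurableSet (B i)) {s : Finset ι} {j : ι} (hj : j ∉ s) :
    (P.restrict ((⋂ i ∈ s, Z (u i) (σ i) ⁻¹' B i) ∩ Z (u j) (σ j) ⁻¹' B j)).map
        (directingMeasure P Z) =
      ((P.restrict (⋂ i ∈ s, Z (u i) (σ i) ⁻¹' B i)).withDensity fun ω =>
        (directingMeasure P Z ω (σ j) : Measure ℝ) (B j)).map (directingMeasure P Z) := by
  have hF : Measurable (directingMeasure P Z) := measurable_directingMeasure hm
  have hFB : Measurable fun ω => (directingMeasure P Z ω (σ j) : Measure ℝ) (B j) :=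
    (measurable_apply_probabilityMeasure (σ j) (hB j)).comp hF
  have hEs := measurableSet_biInter_reward hm u σ hB s
  set E := ⋂ i ∈ s, Z (u i) (σ i) ⁻¹' B i with hE
  have hlim : IsProjectiveLimit (((P.restrict E).withDensity fun ω =>
        (directingMeasure P Z ω (σ j) : Measure ℝ) (B j)).map (directingMeasure P Z))
      fun I : Finset 𝒜 => ((P.restrict (E ∩ Z (u j) (σ j) ⁻¹' B j)).map
        (directingMeasure P Z)).map I.restrict := fun I => by
    have hI := Finset.measurable_restrict (X := fun _ : 𝒜 => ProbabilityMeasure ℝ) I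
    ext C hC
    have hC' : MeasurableSet {ω | I.restrict (directingMeasure P Z ω) ∈ C} := (hI.comp hF) hC
    rw [Measure.map_apply hI hC, Measure.map_apply hI hC, Measure.map_apply hF (hI hC),
      Measure.map_apply hF (hI hC), withDensity_apply _ (hF (hI hC)),
      Measure.restrict_apply (hF (hI hC))]
    have h := hZ.measureReal_inter_reward hm hu σ hB hj I hC
    have hset : directingMeasure P Z ⁻¹' (I.restrict ⁻¹' C) =
      {ω | I.restrict (directingMeasure P Z ω) ∈ C} := rfl
    rw [hset, Measure.restrict_restrict hC', inter_comm _ E, inter_comm _ (E ∩ _),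
      inter_right_comm]
    simp only [measureReal_def] at h
    rw [integral_toReal hFB.aemeasurable (ae_of_all _ fun ω => measure_lt_top _ _)] at h
    refine ((ENNReal.toReal_eq_toReal_iff' (measure_ne_top _ _) ?_).1 h).symm
    refine ((lintegral_mono fun ω => prob_le_one).trans_lt ?_).ne (b := ⊤)
    simp
  exact IsProjectiveLimit.unique (fun _ => rfl) hlim

/-- Given the directing measures, rewards at distinct steps are independent, and their distributions
are the directing measures. -/
theorem setLIntegral_biInter_reward (hZ : IsExchangeableArray P Z)
    (hm : ∀ i a, Measurable (Z i a)) {ι : Type*} {u : ι → ℕ} (hu : u.Injective) (σ : ι → 𝒜)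
    {B : ι → Set ℝ} (hB : ∀ i, MeasurableSet (B i)) (s : Finset ι)
    {g : (𝒜 → ProbabilityMeasure ℝ) → ENNReal} (hg : Measurable g) :
    ∫⁻ ω in ⋂ i ∈ s, Z (u i) (σ i) ⁻¹' B i, g (directingMeasure P Z ω) ∂P =
      ∫⁻ ω, g (directingMeasure P Z ω) *
        ∏ i ∈ s, (directingMeasure P Z ω (σ i) : Measure ℝ) (B i) ∂P := by
  classical
  have hF : Measurable (directingMeasure P Z) := measurable_directingMeasure hm
  induction s using Finset.induction_on generalizing g with
  | empty => simp
  | insert j s hj ih =>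
    have hj' := measurable_apply_probabilityMeasure (σ j) (hB j)
    rw [Finset.set_biInter_insert, inter_comm, ← lintegral_map hg hF,
      hZ.map_restrict_inter_reward hm hu σ hB hj, lintegral_map hg hF,
      lintegral_withDensity_eq_lintegral_mul _
        (f := fun ω => (directingMeasure P Z ω (σ j) : Measure ℝ) (B j))
        (g := fun ω => g (directingMeasure P Z ω))
        (hj'.comp hF) (hg.comp hF)]
    -- The density contributed by the reward `j` is a function of the directing measures, so it is
    -- absorbed into `g`; the induction therefore runs over all `g`.
    have h := ih (hj'.mul hg)
    simp only [Pi.mul_apply] at h ⊢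
    rw [h]
    refine lintegral_congr fun ω => ?_
    rw [Finset.prod_insert hj]
    ring

theorem measure_inter_biInter_reward (hZ : IsExchangeableArray P Z)
    (hm : ∀ i a, Measurable (Z i a)) {ι : Type*} {u : ι → ℕ} (hu : u.Injective) (σ : ι → 𝒜)
    {B : ι → Set ℝ} (hB : ∀ i, MeasurableSet (B i)) (s : Finset ι)
    {G : Set (𝒜 → ProbabilityMeasure ℝ)} (hG : MeasurableSet G) :
    P ((directingMeasure P Z ⁻¹' G) ∩ ⋂ i ∈ s, Z (u i) (σ i) ⁻¹' B i) =
      ∫⁻ ω in directingMeasure P Z ⁻¹' G,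
        ∏ i ∈ s, (directingMeasure P Z ω (σ i) : Measure ℝ) (B i) ∂P := by
  have hG' : MeasurableSet (directingMeasure P Z ⁻¹' G) := measurable_directingMeasure hm hG
  have h := hZ.setLIntegral_biInter_reward hm hu σ hB s
    ((measurable_one (α := ENNReal)).indicator hG)
  have h1 : ∀ ω, G.indicator (1 : (𝒜 → ProbabilityMeasure ℝ) → ENNReal) (directingMeasure P Z ω) =
      (directingMeasure P Z ⁻¹' G).indicator 1 ω := fun ω => rfl
  simp only [h1] at h
  rw [lintegral_indicator_one hG', Measure.restrict_apply hG'] at h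
  rw [h, ← lintegral_indicator hG']
  refine lintegral_congr fun ω => ?_
  by_cases hω : ω ∈ directingMeasure P Z ⁻¹' G <;> simp [hω]

/-- The product is measurable with respect to the directing measures and has the right integral over
every event they generate. -/
theorem condExp_biInter_reward (hZ : IsExchangeableArray P Z)
    (hm : ∀ i a, Measurable (Z i a)) {ι : Type*} {u : ι → ℕ} (hu : u.Injective) (σ : ι → 𝒜)
    {B : ι → Set ℝ} (hB : ∀ i, MeasurableSet (B i)) (s : Finset ι) :
    P⟦⋂ i ∈ s, Z (u i) (σ i) ⁻¹' B i |
        MeasurableSpace.comap (directingMeasure P Z) inferInstance⟧ =ᵐ[P]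
      fun ω => ∏ i ∈ s, (directingMeasure P Z ω (σ i) : Measure ℝ).real (B i) := by
  have hF : Measurable (directingMeasure P Z) := measurable_directingMeasure hm
  have hE := measurableSet_biInter_reward hm u σ hB s
  have hreal : Measurable fun f : 𝒜 → ProbabilityMeasure ℝ =>
      ∏ i ∈ s, (f (σ i) : Measure ℝ).real (B i) :=
    Finset.measurable_fun_prod _ fun i _ =>
      (measurable_apply_probabilityMeasure (σ i) (hB i)).ennreal_toReal
  have hmF : Measurable[MeasurableSpace.comap (directingMeasure P Z) inferInstance] fun ω =>
      ∏ i ∈ s, (directingMeasure P Z ω (σ i) : Measure ℝ).real (B i) :=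
    hreal.comp (comap_measurable _)
  have hint : Integrable (fun ω =>
      ∏ i ∈ s, (directingMeasure P Z ω (σ i) : Measure ℝ).real (B i)) P :=
    integrable_of_abs_le (c := 1) (hreal.comp hF) fun ω => by
      rw [abs_of_nonneg (Finset.prod_nonneg fun i _ => measureReal_nonneg)]
      exact Finset.prod_le_one (fun i _ => measureReal_nonneg) fun i _ => measureReal_le_one
  refine (ae_eq_condExp_of_forall_setIntegral_eq hF.comap_le
    ((integrable_const (1 : ℝ)).indicator hE) (fun _ _ _ => hint.integrableOn) ?_
    hmF.aestronglyMeasurable).symm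
  rintro _ ⟨G, hG, rfl⟩ -
  rw [setIntegral_indicator hE, setIntegral_const, smul_eq_mul, mul_one, measureReal_def,
    hZ.measure_inter_biInter_reward hm hu σ hB s hG]
  simp only [measureReal_def, ← ENNReal.toReal_prod]
  refine integral_toReal ?_ (ae_of_all _ fun ω => ?_)
  · exact (Finset.measurable_fun_prod _ fun i _ =>
      (measurable_apply_probabilityMeasure (σ i) (hB i)).comp hF).aemeasurable
  · exact ENNReal.prod_lt_top fun i _ => measure_lt_top _ _

theorem condDistrib_reward (hZ : IsExchangeableArray P Z) (hm : ∀ i a, Measurable (Z i a))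
    (n : ℕ) (a : 𝒜) :
    ∀ᵐ ω ∂P, condDistrib (Z n a) (directingMeasure P Z) P (directingMeasure P Z ω) =
      (directingMeasure P Z ω a : Measure ℝ) := by
  have hF : Measurable (directingMeasure P Z) := measurable_directingMeasure hm
  -- Evaluation at `a` is a kernel that disintegrates the joint law of the directing measures and
  -- the reward; conditional distributions are almost surely unique.
  let κ : Kernel (𝒜 → ProbabilityMeasure ℝ) ℝ :=
    ⟨fun f => (f a : Measure ℝ), measurable_subtype_coe.comp (measurable_pi_apply a)⟩
  have : IsMarkovKernel κ := ⟨fun f => (f a).2⟩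
  have hκ : P.map (fun ω => (directingMeasure P Z ω, Z n a ω)) =
      P.map (directingMeasure P Z) ⊗ₘ κ := by
    have := Measure.isProbabilityMeasure_map (μ := P) (hF.prodMk (hm n a)).aemeasurable
    refine Measure.ext_prod fun {G B} hG hB => ?_
    rw [Measure.compProd_apply_prod hG hB, setLIntegral_map hG (κ.measurable_coe hB) hF,
      Measure.map_apply (hF.prodMk (hm n a)) (hG.prod hB)]
    have h := hZ.measure_inter_biInter_reward hm (u := fun _ : Unit => n)
      (Function.injective_of_subsingleton _) (fun _ => a) (fun _ => hB) {()} hG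
    simp only [Finset.mem_singleton, iInter_const, Finset.prod_singleton] at h
    exact h
  exact ae_of_ae_map hF.aemeasurable
    (condDistrib_ae_eq_of_measure_eq_compProd _ (hm n a).aemeasurable hκ)

end IsExchangeableArray

/-! ### From decision processes to exchangeable arrays -/

namespace StatelessDecisionProcess

variable {𝒜 Ω : Type*} [MeasurableSpace Ω] {P : Measure Ω} [IsProbabilityMeasure P]

/-- The reward at step `i` when the action `a` is played at all steps of an infinite horizon. -/
def constReward (D : StatelessDecisionProcess 𝒜 P) (i : ℕ) (a : 𝒜) (ω : Ω) : ℝ :=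
  D.rewards ⊤ ω (fun _ => a) ⟨i, ENat.natCast_lt_top i⟩

theorem measurable_constReward (D : StatelessDecisionProcess 𝒜 P) (i : ℕ) (a : 𝒜) :
    Measurable (D.constReward i a) :=
  (measurable_pi_apply _).comp ((measurable_pi_apply _).comp (D.measurable_rewards ⊤))

/-- Coherence is used on the one-step window `h = k = i`, against the constant sequence of infinite
horizon. -/
theorem Coherent.rewards_eq {D : StatelessDecisionProcess 𝒜 P} (hcoh : D.Coherent) {H : ℕ∞}
    (τ : Steps H → 𝒜) (i : Steps H) :
    (fun ω => D.rewards H ω τ i) = D.constReward i (τ i) :=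
  hcoh H ⊤ τ (fun _ => τ i) i i le_rfl i.2 (ENat.natCast_lt_top _)
    (fun _ _ _ h h' => congrArg τ (Subtype.ext (le_antisymm h' h))) i i.2 (ENat.natCast_lt_top _)
    le_rfl le_rfl

theorem Coherent.isExchangeableArray {D : StatelessDecisionProcess 𝒜 P} (hcoh : D.Coherent)
    (hexch : D.Exchangeable) : IsExchangeableArray P D.constReward := by
  intro π σ
  let ε : ℕ ≃ Steps ⊤ := ⟨fun i => ⟨i, ENat.natCast_lt_top i⟩, Subtype.val, fun _ => rfl, fun _ => rfl⟩
  -- With `π.symm` here, `τ` plays `σ i` at step `π i`, and its permuted sequence plays `σ i` at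
  -- step `i`.
  let τ : Steps ⊤ → 𝒜 := fun i => σ (π.symm i)
  have h := hexch ⊤ (ε.permCongr π) τ
  have hτ : ∀ (τ : Steps ⊤ → 𝒜) (i : Steps ⊤) (ω : Ω),
      D.rewards ⊤ ω τ i = D.constReward i (τ i) ω := fun τ i ω => congrFun (hcoh.rewards_eq τ i) ω
  have hr : Measurable fun (y : Steps ⊤ → ℝ) (i : ℕ) => y (ε i) := by fun_prop
  have h' := (h.comp hr).map_eq
  simpa [Function.comp_def, hτ, τ, ε, Equiv.permCongr_apply] using h'

end StatelessDecisionProcess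

/-- De Finetti theorem for stateless decision processes: every exchangeable and coherent stateless
decision process is a latent bandit. -/
theorem theorem6 {𝒜 Ω : Type*} [MeasurableSpace Ω] (P : Measure Ω) [IsProbabilityMeasure P]
    (D : StatelessDecisionProcess 𝒜 P) (hexch : D.Exchangeable) (hcoh : D.Coherent) :
    D.IsLatentBandit := by
  classical
  have hZ := hcoh.isExchangeableArray hexch
  have hm := D.measurable_constReward
  refine ⟨IsExchangeableArray.directingMeasure P D.constReward,
    IsExchangeableArray.measurable_directingMeasure hm, fun H τ => ⟨?_, fun h => ?_⟩⟩
  · intro s B hB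
    -- `B` is measurable only on `s`, while the array lemmas require it at every index.
    let B' : Steps H → Set ℝ := fun i => if i ∈ s then B i else univ
    have hB' : ∀ i, MeasurableSet (B' i) := fun i => by
      by_cases hi : i ∈ s
      · simpa [B', hi] using hB i hi
      · simp [B', hi]
    have hBB' : ∀ i ∈ s, B' i = B i := fun i hi => if_pos hi
    have hall := hZ.condExp_biInter_reward hm Subtype.val_injective τ hB'
    -- The singleton case identifies each factor of the product of conditional probabilities.
    have hone : ∀ᵐ ω ∂P, ∀ i : s, (P⟦D.constReward i (τ i) ⁻¹' B' i |
        MeasurableSpace.comap (IsExchangeableArray.directingMeasure P D.constReward)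
          inferInstance⟧) ω =
        (IsExchangeableArray.directingMeasure P D.constReward ω (τ i) : Measure ℝ).real (B' i) :=
      ae_all_iff.2 fun i => by
        have h := hall {i.1}
        simp only [Finset.mem_singleton, iInter_iInter_eq_left, Finset.prod_singleton] at h
        exact h
    simp only [hcoh.rewards_eq τ]
    rw [← iInter₂_congr fun (i : Steps H) hi => congrArg (D.constReward i (τ i) ⁻¹' ·) (hBB' i hi)]
    filter_upwards [hall s, hone] with ω h1 h2
    rw [h1, Finset.prod_apply]
    refine Finset.prod_congr rfl fun i hi => ?_
    rw [← h2 ⟨i, hi⟩, hBB' i hi]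
  · rw [hcoh.rewards_eq τ h]
    exact hZ.condDistrib_reward hm h (τ h)
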